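/- Let $a \ge 2$ and $n \ge 1$ be integers. For any coloring of the integers in $[1,n]$ with two colors, let $Q$ be twice the number of ordered triples $(x,y,z)$ of integers in $[1,n]$ with $x+ay=z$ that are not monochromatic (that is, $x,y,z$ do not all have the same color). Then $$Q \le \frac{n^2}{a}\left(1-\frac{1}{a^2+2a+3}\right).$$ -/

import Mathlib

/-- The non-monochromatic solutions `(x, y, z)` of `x + a * y = z` with `x, y, z ∈ [1, n]`,
for a 2-coloring `χ`; only the values of `χ` on `[1, n]` matter. -/
def nonMonoSolutions (a n : ℕ) (χ : ℕ → Bool) : Finset (ℕ × ℕ × ℕ) :=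
  (Finset.Icc 1 n ×ˢ Finset.Icc 1 n ×ˢ Finset.Icc 1 n).filter fun t =>
    t.1 + a * t.2.1 = t.2.2 ∧ ¬ (χ t.1 = χ t.2.1 ∧ χ t.2.1 = χ t.2.2)

/-- Twice the number of non-monochromatic solutions of `x + a * y = z` in `[1, n]`. -/
def nonMonoQ (a n : ℕ) (χ : ℕ → Bool) : ℕ :=
  2 * (nonMonoSolutions a n χ).card

/-! A non-monochromatic triple contains exactly two bichromatic pairs, so `Q` counts the bichromatic
pairs `(x, y)`, `(y, z)`, `(x, z)` over all solutions.

The pairs `(x, z)` lie in one residue class mod `a`; Cauchy–Schwarz over the classes bounds them by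
`R * B / a + a / 16`, where `R` and `B` are the colour counts on `[1, n]`
(`sum_same_residue_ne_le`).

For the other pairs, put `m = (n - 1) / a` and match `y` with `m + 1 - y`. Prefix counts nearly
cancel, and only matched pairs of different colours give an excess (`sum_pairCount_le`). This excess
lies below a trapezoid in `y`, and the number of such pairs is at most the count of either colour on
`[1, m]`; a Lagrange multiplier `μ` combines the two constraints (`mul_sum_le_of_trapezoid`,
`mul_nonMonoQ_le`).

What remains is a quadratic optimization in four colour counts. In the critical case the deficit
from `n ^ 2` is a sum of three squares under a linear constraint with coefficients `1, 1, a + 1`,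
and `1 + 1 + (a + 1) ^ 2 = a ^ 2 + 2 * a + 3`. The trivial bound handles `m + 1 ≤ a ^ 2 + 2 * a +
3`. -/

/-- The number of integers in `[1, i]` of colour `c`. -/
def colorCount (χ : ℕ → Bool) (c : Bool) (i : ℕ) : ℕ :=
  ((Finset.Icc 1 i).filter fun x => χ x = c).card

theorem colorCount_mono (χ : ℕ → Bool) (c : Bool) : Monotone (colorCount χ c) := fun _ _ h =>
  Finset.card_le_card (Finset.filter_subset_filter _ (Finset.Icc_subset_Icc_right h))

theorem colorCount_add_not (χ : ℕ → Bool) (c : Bool) (i : ℕ) :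
    colorCount χ c i + colorCount χ (!c) i = i := by
  have h := Finset.card_filter_add_card_filter_not (s := Finset.Icc 1 i) (fun x => χ x = c)
  have h2 : (Finset.Icc 1 i).filter (fun x => χ x = !c) =
      (Finset.Icc 1 i).filter (fun x => ¬ χ x = c) :=
    Finset.filter_congr fun x _ => by cases χ x <;> cases c <;> simp
  rw [colorCount, colorCount, h2, h]
  simp

theorem colorCount_le_add (χ : ℕ → Bool) (c : Bool) {i j : ℕ} (h : i ≤ j) :
    colorCount χ c j + i ≤ colorCount χ c i + j := by
  have h1 := colorCount_add_not χ c i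
  have h2 := colorCount_add_not χ c j
  have h3 := colorCount_mono χ (!c) h
  omega

theorem sum_ne_eq_colorCount (χ : ℕ → Bool) (c : Bool) (k : ℕ) :
    ∑ x ∈ Finset.Icc 1 k, (if χ x ≠ c then (1 : ℝ) else 0) = colorCount χ (!c) k := by
  rw [colorCount, Finset.card_filter]
  push_cast
  refine Finset.sum_congr rfl fun x _ => ?_
  cases χ x <;> cases c <;> simp

theorem sum_shift_ne_eq_colorCount (χ : ℕ → Bool) (c : Bool) {s n : ℕ} (h : s ≤ n) :
    ∑ x ∈ Finset.Icc 1 (n - s), (if χ (x + s) ≠ c then (1 : ℝ) else 0) =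
      colorCount χ (!c) n - colorCount χ (!c) s := by
  obtain ⟨k, rfl⟩ := Nat.exists_eq_add_of_le h
  rw [← sum_ne_eq_colorCount, ← sum_ne_eq_colorCount, Nat.add_sub_cancel_left]
  induction k with
  | zero => simp
  | succ k ih =>
    rw [Finset.sum_Icc_succ_top (by omega), ih (by omega), ← add_assoc,
      Finset.sum_Icc_succ_top (by omega), show k + 1 + s = s + k + 1 by ring]
    ring

/-! ### Reduction to bichromatic pairs -/

/-- Twice the number of non-monochromatic solutions, counted by bichromatic pairs. -/
theorem nonMonoQ_eq_sum (a n : ℕ) (ha : 1 ≤ a) (χ : ℕ → Bool) :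
    (nonMonoQ a n χ : ℝ) = ∑ y ∈ Finset.Icc 1 ((n - 1) / a), ∑ x ∈ Finset.Icc 1 (n - a * y),
      ((if χ x ≠ χ y then (1 : ℝ) else 0) + (if χ (x + a * y) ≠ χ y then (1 : ℝ) else 0) +
        (if χ x ≠ χ (x + a * y) then (1 : ℝ) else 0)) := by
  have hcard : (nonMonoSolutions a n χ).card =
      ((((Finset.Icc 1 ((n - 1) / a)).sigma fun y => Finset.Icc 1 (n - a * y))).filter
        fun t => ¬ (χ t.2 = χ t.1 ∧ χ t.1 = χ (t.2 + a * t.1))).card := by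
    refine Finset.card_nbij' (fun t => ⟨t.2.1, t.1⟩) (fun t => (t.2, t.1, t.2 + a * t.1))
      ?_ ?_ ?_ ?_
    · rintro ⟨x, y, z⟩ h
      simp only [nonMonoSolutions, Finset.coe_filter, Finset.mem_product, Finset.mem_Icc,
        Set.mem_ofPred_eq, Finset.mem_sigma] at h ⊢
      obtain ⟨⟨⟨hx, _⟩, ⟨hy, _⟩, _, hz⟩, rfl, hχ⟩ := h
      refine ⟨⟨⟨hy, ?_⟩, hx, by omega⟩, hχ⟩
      rw [Nat.le_div_iff_mul_le ha, mul_comm]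
      omega
    · rintro ⟨y, x⟩ h
      simp only [nonMonoSolutions, Finset.coe_filter, Finset.mem_product, Finset.mem_Icc,
        Set.mem_ofPred_eq, Finset.mem_sigma] at h ⊢
      obtain ⟨⟨⟨hy, _⟩, hx, hz⟩, hχ⟩ := h
      have : y ≤ a * y := Nat.le_mul_of_pos_left y ha
      refine ⟨⟨⟨hx, by omega⟩, ⟨hy, by omega⟩, by omega, by omega⟩, trivial, hχ⟩
    · rintro ⟨x, y, z⟩ h
      simp only [nonMonoSolutions, Finset.coe_filter, Finset.mem_product, Finset.mem_Icc,
        Set.mem_ofPred_eq] at h ⊢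
      rw [h.2.1]
    · rintro ⟨y, x⟩ _
      rfl
  rw [nonMonoQ, hcard, Finset.card_filter]
  push_cast
  rw [Finset.sum_sigma, Finset.mul_sum]
  refine Finset.sum_congr rfl fun y _ => ?_
  rw [Finset.mul_sum]
  refine Finset.sum_congr rfl fun x _ => ?_
  cases χ x <;> cases χ y <;> cases χ (x + a * y) <;> norm_num

theorem sum_Icc_mul_natCast (a : ℝ) (k : ℕ) :
    ∑ y ∈ Finset.Icc 1 k, a * (y : ℝ) = a * (k * (k + 1)) / 2 := by
  induction k with
  | zero => simp
  | succ k ih =>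
    rw [Finset.sum_Icc_succ_top (by omega), ih]
    push_cast
    ring

theorem mul_le_of_mem_Icc_div {a n y : ℕ} (ha : 1 ≤ a) (hy : y ∈ Finset.Icc 1 ((n - 1) / a)) :
    a * y + 1 ≤ n := by
  rw [Finset.mem_Icc] at hy
  have h1 := (Nat.le_div_iff_mul_le ha).1 hy.2
  have : 1 ≤ y * a := Nat.mul_pos hy.1 ha
  rw [mul_comm]
  omega

theorem sum_card_solutions (a n : ℕ) (ha : 1 ≤ a) :
    ∑ y ∈ Finset.Icc 1 ((n - 1) / a), ∑ _x ∈ Finset.Icc 1 (n - a * y), (1 : ℝ) =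
      n * ((n - 1) / a : ℕ) - a * (((n - 1) / a : ℕ) * (((n - 1) / a : ℕ) + 1)) / 2 := by
  rw [← sum_Icc_mul_natCast]
  have : ∀ y ∈ Finset.Icc 1 ((n - 1) / a), ∑ _x ∈ Finset.Icc 1 (n - a * y), (1 : ℝ) =
      n - a * (y : ℝ) := fun y hy => by
    have := mul_le_of_mem_Icc_div ha hy
    simp only [Finset.sum_const, Nat.card_Icc, nsmul_eq_mul, mul_one, Nat.add_sub_cancel]
    rw [Nat.cast_sub (by omega)]
    push_cast
    ring
  rw [Finset.sum_congr rfl this, Finset.sum_sub_distrib]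
  simp
  ring

/-- Counting every solution as non-monochromatic. -/
theorem nonMonoQ_le_two_mul_card (a n : ℕ) (ha : 1 ≤ a) (χ : ℕ → Bool) :
    (nonMonoQ a n χ : ℝ) ≤
      2 * (n * ((n - 1) / a : ℕ) - a * (((n - 1) / a : ℕ) * (((n - 1) / a : ℕ) + 1)) / 2) := by
  rw [nonMonoQ_eq_sum a n ha, ← sum_card_solutions a n ha, Finset.mul_sum]
  refine Finset.sum_le_sum fun y _ => ?_
  rw [Finset.mul_sum]
  refine Finset.sum_le_sum fun x _ => ?_
  cases χ x <;> cases χ y <;> cases χ (x + a * y) <;> norm_num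

/-! ### Pairs in a common residue class -/

/-- Autocorrelations along multiples of `a` are bounded below by the residue classes mod `a`. -/
theorem sq_sum_le_autocorrelation (a n : ℕ) (ha : 1 ≤ a) (ε : ℕ → ℝ) :
    (∑ x ∈ Finset.Icc 1 n, ε x) ^ 2 ≤ a * (∑ x ∈ Finset.Icc 1 n, ε x ^ 2 +
      2 * ∑ y ∈ Finset.Icc 1 ((n - 1) / a), ∑ x ∈ Finset.Icc 1 (n - a * y),
        ε x * ε (x + a * y)) := by
  have hfib : ∑ i ∈ Finset.range a, ∑ x ∈ (Finset.Icc 1 n).filter (fun x => x % a = i), ε x =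
      ∑ x ∈ Finset.Icc 1 n, ε x :=
    Finset.sum_fiberwise_of_maps_to (fun x _ => Finset.mem_range.2 (Nat.mod_lt _ ha)) _
  have hcs := sq_sum_le_card_mul_sum_sq (s := Finset.range a)
    (f := fun i => ∑ x ∈ (Finset.Icc 1 n).filter (fun x => x % a = i), ε x)
  rw [hfib, Finset.card_range] at hcs
  refine hcs.trans_eq ?_
  congr 1
  have hsq : ∑ i ∈ Finset.range a, (∑ x ∈ (Finset.Icc 1 n).filter (fun x => x % a = i), ε x) ^ 2 =
      ∑ x ∈ Finset.Icc 1 n, ∑ z ∈ Finset.Icc 1 n, if x % a = z % a then ε x * ε z else 0 := by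
    rw [← Finset.sum_fiberwise_of_maps_to (s := Finset.Icc 1 n) (t := Finset.range a)
      (g := fun x => x % a) (fun x _ => Finset.mem_range.2 (Nat.mod_lt _ ha))]
    refine Finset.sum_congr rfl fun i _ => ?_
    rw [sq, Finset.sum_mul_sum]
    refine Finset.sum_congr rfl fun x hx => ?_
    rw [Finset.sum_filter]
    refine Finset.sum_congr rfl fun z _ => ?_
    rw [(Finset.mem_filter.1 hx).2]
    simp only [eq_comm]
  have hlt : ∑ y ∈ Finset.Icc 1 ((n - 1) / a), ∑ x ∈ Finset.Icc 1 (n - a * y),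
      ε x * ε (x + a * y) = ∑ x ∈ Finset.Icc 1 n, ∑ z ∈ Finset.Icc 1 n,
        if x < z ∧ x % a = z % a then ε x * ε z else 0 := by
    rw [Finset.sum_sigma', ← Finset.sum_product', ← Finset.sum_filter]
    refine Finset.sum_nbij' (fun t => (t.2, t.2 + a * t.1)) (fun t => ⟨(t.2 - t.1) / a, t.1⟩)
      ?_ ?_ ?_ ?_ ?_
    · rintro ⟨y, x⟩ h
      simp only [Finset.mem_filter, Finset.mem_product, Finset.mem_Icc, Finset.mem_sigma] at h ⊢
      have : 1 ≤ a * y := Nat.mul_pos ha h.1.1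
      refine ⟨⟨⟨h.2.1, by omega⟩, by omega, by omega⟩, by omega, by simp⟩
    · rintro ⟨x, z⟩ h
      simp only [Finset.mem_filter, Finset.mem_product, Finset.mem_Icc, Finset.mem_sigma] at h ⊢
      obtain ⟨⟨⟨hx, hx'⟩, hz, hz'⟩, hlt, hmod⟩ := h
      obtain ⟨k, hk⟩ := (Nat.modEq_iff_dvd' hlt.le).1 hmod
      have hk' : (z - x) / a = k := by rw [hk, Nat.mul_div_cancel_left _ ha]
      have : 0 < k := Nat.pos_of_ne_zero fun h => by subst h; omega
      rw [hk']
      refine ⟨⟨this, ?_⟩, hx, by omega⟩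
      rw [Nat.le_div_iff_mul_le ha, mul_comm]
      omega
    · rintro ⟨y, x⟩ _
      simp [Nat.mul_div_cancel_left _ ha]
    · rintro ⟨x, z⟩ h
      simp only [Finset.mem_filter, Finset.mem_product, Finset.mem_Icc] at h ⊢
      obtain ⟨_, hlt, hmod⟩ := h
      rw [Nat.mul_div_cancel' ((Nat.modEq_iff_dvd' hlt.le).1 hmod)]
      simp only [Prod.mk.injEq, true_and]
      omega
    · rintro ⟨y, x⟩ _
      rfl
  have hgt : ∑ x ∈ Finset.Icc 1 n, ∑ z ∈ Finset.Icc 1 n,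
      (if x < z ∧ x % a = z % a then ε x * ε z else 0) = ∑ x ∈ Finset.Icc 1 n,
        ∑ z ∈ Finset.Icc 1 n, if z < x ∧ x % a = z % a then ε x * ε z else 0 := by
    rw [Finset.sum_comm]
    refine Finset.sum_congr rfl fun x _ => Finset.sum_congr rfl fun z _ => ?_
    exact if_congr (and_congr_right fun _ => eq_comm) (mul_comm _ _) rfl
  rw [hsq, two_mul, hlt]
  nth_rewrite 2 [hgt]
  rw [← Finset.sum_add_distrib, ← Finset.sum_add_distrib]
  refine Finset.sum_congr rfl fun x hx => ?_
  have hd : ε x ^ 2 = ∑ z ∈ Finset.Icc 1 n, if z = x then ε x * ε z else 0 := by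
    rw [Finset.sum_ite_eq' _ x, if_pos hx, sq]
  rw [hd, ← Finset.sum_add_distrib, ← Finset.sum_add_distrib]
  refine Finset.sum_congr rfl fun z _ => ?_
  rcases lt_trichotomy x z with h | h | h
  · simp [h, h.ne', h.not_gt]
  · simp [h]
  · simp [h, h.ne, h.not_gt]

/-- The bichromatic pairs `(x, z)` with `x < z` in the same residue class mod `a`. -/
theorem sum_same_residue_ne_le (a n : ℕ) (ha : 1 ≤ a) (χ : ℕ → Bool) (c : Bool) :
    a * ∑ y ∈ Finset.Icc 1 ((n - 1) / a), ∑ x ∈ Finset.Icc 1 (n - a * y),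
        (if χ x ≠ χ (x + a * y) then (1 : ℝ) else 0) ≤
      colorCount χ c n * colorCount χ (!c) n + (a : ℝ) ^ 2 / 16 := by
  set ε : ℕ → ℝ := fun x => if χ x ≠ c then 1 else -1 with hε
  have h1 := sq_sum_le_autocorrelation a n ha ε
  have hsum : ∑ x ∈ Finset.Icc 1 n, ε x = 2 * colorCount χ (!c) n - n := by
    rw [← sum_ne_eq_colorCount, Finset.mul_sum]
    have : (n : ℝ) = ∑ x ∈ Finset.Icc 1 n, (1 : ℝ) := by simp
    rw [this, ← Finset.sum_sub_distrib]
    refine Finset.sum_congr rfl fun x _ => ?_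
    simp only [hε]
    split_ifs <;> norm_num
  have hsq : ∑ x ∈ Finset.Icc 1 n, ε x ^ 2 = n := by
    have : (n : ℝ) = ∑ x ∈ Finset.Icc 1 n, (1 : ℝ) := by simp
    rw [this]
    refine Finset.sum_congr rfl fun x _ => ?_
    simp only [hε]
    split_ifs <;> norm_num
  have hne : ∑ y ∈ Finset.Icc 1 ((n - 1) / a), ∑ x ∈ Finset.Icc 1 (n - a * y),
        (if χ x ≠ χ (x + a * y) then (1 : ℝ) else 0) =
      (∑ y ∈ Finset.Icc 1 ((n - 1) / a), ∑ _x ∈ Finset.Icc 1 (n - a * y), (1 : ℝ) -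
      ∑ y ∈ Finset.Icc 1 ((n - 1) / a), ∑ x ∈ Finset.Icc 1 (n - a * y),
        ε x * ε (x + a * y)) / 2 := by
    rw [← Finset.sum_sub_distrib, Finset.sum_div]
    refine Finset.sum_congr rfl fun y _ => ?_
    rw [← Finset.sum_sub_distrib, Finset.sum_div]
    refine Finset.sum_congr rfl fun x _ => ?_
    simp only [hε]
    cases χ x <;> cases χ (x + a * y) <;> cases c <;> norm_num
  have hRB : (colorCount χ c n : ℝ) = n - colorCount χ (!c) n := by
    have := colorCount_add_not χ c n
    rw [eq_sub_iff_add_eq]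
    exact_mod_cast this
  rw [hne, sum_card_solutions a n ha, hRB]
  rw [hsum, hsq] at h1
  -- With `k = (n - 1) / a`, what is left to show is `0 ≤ (n - a * k - a / 2) ^ 2 / 4`.
  nlinarith [sq_nonneg (2 * ((n : ℝ) - a * ((n - 1) / a : ℕ)) - a)]

/-! ### Summing a trapezoid -/

/-- Sum of a truncated concave piecewise linear function over a set of multiples of `a`. -/
theorem mul_sum_le_of_trapezoid {a B β μ : ℝ} (ha : 0 < a) (hβ : 0 ≤ β) (hβB : β ≤ B)
    (hBβ : B ≤ 2 * β) (hμ : B ≤ μ) (E : Finset ℕ) (hE : ∀ y ∈ E, 1 ≤ y) (u : ℕ → ℝ)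
    (h1 : ∀ y ∈ E, u y ≤ 2 * μ - 2 * (a * y)) (h2 : ∀ y ∈ E, u y ≤ 2 * μ - 2 * β)
    (h3 : ∀ y ∈ E, u y ≤ 2 * μ - 2 * B + 2 * (a * y)) :
    a * ∑ y ∈ E, u y ≤ μ ^ 2 - ((B - β) ^ 2 + β ^ 2) - a * (μ - B) + a ^ 2 / 4 := by
  set p := ⌊(B - β) / a⌋₊
  set q := ⌊β / a⌋₊
  set k := ⌊μ / a⌋₊
  have hpq : p ≤ q := Nat.floor_mono (by gcongr; linarith)
  have hqk : q ≤ k := Nat.floor_mono (by gcongr; linarith)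
  have floor_iff : ∀ {t : ℝ}, 0 ≤ t → ∀ y : ℕ, y ≤ ⌊t / a⌋₊ ↔ a * y ≤ t := fun {t} ht y => by
    rw [Nat.le_floor_iff (by positivity), le_div_iff₀ ha, mul_comm]
  have hp : ∀ y : ℕ, y ≤ p ↔ a * y ≤ B - β := floor_iff (by linarith)
  have hq : ∀ y : ℕ, y ≤ q ↔ a * y ≤ β := floor_iff hβ
  have hk : ∀ y : ℕ, y ≤ k ↔ a * y ≤ μ := floor_iff (by linarith)
  -- The positive part of the trapezoid is the ramp of height `2 * μ` minus the ramps of heights `2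
  -- * β` and `2 * (B - β)`, all of slope `-2 * a`.
  set H : ℕ → ℝ := fun y => (if y ≤ k then 2 * μ - 2 * (a * y) else 0) +
    (if y ≤ q then 2 * (a * y) - 2 * β else 0) +
    (if y ≤ p then 2 * (a * y) - 2 * (B - β) else 0) with hH
  have hcases : ∀ y : ℕ, 0 ≤ H y ∧ (y ∈ E → u y ≤ H y) := fun y => by
    simp only [hH]
    have ay : 0 ≤ a * (y : ℝ) := by positivity
    by_cases hy : y ≤ p
    · rw [if_pos hy, if_pos (hy.trans hpq), if_pos (hy.trans (hpq.trans hqk))]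
      exact ⟨by linarith, fun h => by linarith [h3 y h]⟩
    by_cases hy' : y ≤ q
    · rw [if_neg hy, if_pos hy', if_pos (hy'.trans hqk)]
      exact ⟨by linarith, fun h => by linarith [h2 y h]⟩
    by_cases hy'' : y ≤ k
    · rw [if_neg hy, if_neg hy', if_pos hy'']
      exact ⟨by linarith [(hk y).1 hy''], fun h => by linarith [h1 y h]⟩
    · rw [if_neg hy, if_neg hy', if_neg hy'']
      have := (hk y).not.1 hy''
      exact ⟨by linarith, fun h => by linarith [h1 y h]⟩
  have hsub : ∑ y ∈ E, u y ≤ ∑ y ∈ Finset.Icc 1 k, H y := by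
    calc ∑ y ∈ E, u y ≤ ∑ y ∈ E, H y := Finset.sum_le_sum fun y hy => (hcases y).2 hy
      _ ≤ ∑ y ∈ E ∪ Finset.Icc 1 k, H y :=
        Finset.sum_le_sum_of_subset_of_nonneg Finset.subset_union_left
          fun y _ _ => (hcases y).1
      _ = ∑ y ∈ Finset.Icc 1 k, H y := by
        refine (Finset.sum_subset Finset.subset_union_right fun y hy hy' => ?_).symm
        have hy1 : 1 ≤ y := by
          rcases Finset.mem_union.1 hy with h | h
          · exact hE y h
          · exact (Finset.mem_Icc.1 h).1
        have hyk : ¬ y ≤ k := fun h => hy' (Finset.mem_Icc.2 ⟨hy1, h⟩)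
        simp only [hH]
        rw [if_neg hyk, if_neg fun h => hyk (h.trans hqk),
          if_neg fun h => hyk (h.trans (hpq.trans hqk))]
        simp
  have htrunc : ∀ j ≤ k, ∀ t : ℝ,
      ∑ y ∈ Finset.Icc 1 k, (if y ≤ j then 2 * (a * (y : ℝ)) - 2 * t else 0) =
        a * (j * (j + 1)) - 2 * t * j := fun j hj t => by
    rw [← Finset.sum_filter]
    have : (Finset.Icc 1 k).filter (fun y => y ≤ j) = Finset.Icc 1 j := by
      ext y
      simp only [Finset.mem_filter, Finset.mem_Icc]
      omega
    rw [this, Finset.sum_sub_distrib, ← Finset.mul_sum, sum_Icc_mul_natCast]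
    simp
    ring
  have hsum : ∑ y ∈ Finset.Icc 1 k, H y = -(a * (k * (k + 1)) - 2 * μ * k) +
      (a * (q * (q + 1)) - 2 * β * q) + (a * (p * (p + 1)) - 2 * (B - β) * p) := by
    simp only [hH]
    rw [Finset.sum_add_distrib, Finset.sum_add_distrib, htrunc q hqk, htrunc p (hpq.trans hqk),
      ← htrunc k le_rfl, ← Finset.sum_neg_distrib]
    congr 2
    refine Finset.sum_congr rfl fun y _ => ?_
    split_ifs <;> ring
  -- Subtracted ramps need lower bounds, which hold without rounding loss because `j` is the floor
  -- of `t / a`.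
  have hround : ∀ (t : ℝ) (j : ℕ), a * j ≤ t → t ≤ a * (j + 1) →
      a * (a * (j * (j + 1)) - 2 * t * j) ≤ - t ^ 2 + a * t := fun t j h h' => by
    nlinarith [mul_nonneg (sub_nonneg.2 h) (sub_nonneg.2 h')]
  have hp' := hround (B - β) p ((hp p).1 le_rfl) (by
    have := (hp (p + 1)).not.1 (by omega)
    push_cast at this
    linarith)
  have hq' := hround β q ((hq q).1 le_rfl) (by
    have := (hq (q + 1)).not.1 (by omega)
    push_cast at this
    linarith)
  have := mul_le_mul_of_nonneg_left hsub ha.le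
  rw [hsum] at this
  -- The added ramp is bounded by completing the square in `k`, which costs the `a ^ 2 / 4`.
  nlinarith [sq_nonneg (μ - a / 2 - a * k)]

/-! ### Matching `y` with `m + 1 - y` -/

/-- The number of bichromatic pairs `(x, y)` and `(y, z)` over the solutions with a given `y`. -/
noncomputable def pairCount (a n : ℕ) (χ : ℕ → Bool) (y : ℕ) : ℝ :=
  colorCount χ (!χ y) (n - a * y) + (colorCount χ (!χ y) n - colorCount χ (!χ y) (a * y))

theorem sum_eq_pairCount {a n y : ℕ} (χ : ℕ → Bool) (h : a * y ≤ n) :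
    ∑ x ∈ Finset.Icc 1 (n - a * y), ((if χ x ≠ χ y then (1 : ℝ) else 0) +
      (if χ (x + a * y) ≠ χ y then (1 : ℝ) else 0)) = pairCount a n χ y := by
  rw [Finset.sum_add_distrib, sum_ne_eq_colorCount, sum_shift_ne_eq_colorCount χ _ h, pairCount]

/-- Since `n - a * y ≤ a * z` and `n - a * z ≤ a * y`, each added prefix count is absorbed by a
subtracted one of the same colour. -/
theorem pairCount_add_le_of_eq {a n y z : ℕ} {χ : ℕ → Bool} (hyz : n ≤ a * y + a * z)
    (hz : a * z ≤ n) (hc : χ y = χ z) :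
    pairCount a n χ y + pairCount a n χ z ≤
      colorCount χ (!χ y) n + colorCount χ (!χ z) n := by
  have h1 : (colorCount χ (!χ y) (n - a * y) : ℝ) ≤ colorCount χ (!χ y) (a * z) :=
    Nat.cast_le.2 (colorCount_mono _ _ (by omega))
  have h2 : (colorCount χ (!χ y) (n - a * z) : ℝ) ≤ colorCount χ (!χ y) (a * y) :=
    Nat.cast_le.2 (colorCount_mono _ _ (by omega))
  rw [pairCount, pairCount, ← hc]
  linarith

/-- The excess contributed by the pair `y, m + 1 - y` when it is bichromatic. -/
noncomputable def pairExcess (a n : ℕ) (χ : ℕ → Bool) (y : ℕ) : ℝ :=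
  n - 2 * (a * y) -
    2 * ((colorCount χ (χ y) (n - a * y) : ℝ) - colorCount χ (χ y) (a * y))

/-- The prefix counts now concern opposite colours; expressing everything in the colour of `y`
leaves the excess. -/
theorem pairCount_add_le_of_ne {a n y z : ℕ} {χ : ℕ → Bool} (hyz : n ≤ a * y + a * z)
    (hy : a * y ≤ n) (hc : χ z = !χ y) :
    pairCount a n χ y + pairCount a n χ z ≤
      colorCount χ (!χ y) n + colorCount χ (!χ z) n + pairExcess a n χ y := by
  have h1 : (colorCount χ (χ y) (n - a * y) : ℝ) ≤ colorCount χ (χ y) (a * z) :=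
    Nat.cast_le.2 (colorCount_mono _ _ (by omega))
  have h2 : (colorCount χ (χ y) (n - a * z) : ℝ) ≤ colorCount χ (χ y) (a * y) :=
    Nat.cast_le.2 (colorCount_mono _ _ (by omega))
  have h3 : (colorCount χ (χ y) (n - a * y) : ℝ) + colorCount χ (!χ y) (n - a * y) =
      n - a * y := by
    have := colorCount_add_not χ (χ y) (n - a * y)
    rw [← Nat.cast_mul, ← Nat.cast_sub hy]
    exact_mod_cast this
  have h4 : (colorCount χ (χ y) (a * y) : ℝ) + colorCount χ (!χ y) (a * y) = a * y :=
    mod_cast colorCount_add_not χ (χ y) (a * y)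
  rw [pairCount, pairCount, pairExcess, hc, Bool.not_not]
  linarith

/-- The lower halves of the bichromatic pairs `y, m + 1 - y`. -/
def bichromaticPairs (m : ℕ) (χ : ℕ → Bool) : Finset ℕ :=
  (Finset.Icc 1 m).filter fun y => 2 * y ≤ m ∧ χ (m + 1 - y) = !χ y

theorem mem_bichromaticPairs {m : ℕ} {χ : ℕ → Bool} {y : ℕ} :
    y ∈ bichromaticPairs m χ ↔ (1 ≤ y ∧ y ≤ m) ∧ 2 * y ≤ m ∧ χ (m + 1 - y) = !χ y := by
  rw [bichromaticPairs, Finset.mem_filter, Finset.mem_Icc]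

/-- Each bichromatic pair contains exactly one element of colour `c`, and the pairs are disjoint. -/
theorem card_bichromaticPairs_le (m : ℕ) (χ : ℕ → Bool) (c : Bool) :
    (bichromaticPairs m χ).card ≤ colorCount χ c m := by
  refine Finset.card_le_card_of_injOn (fun y => if χ y = c then y else m + 1 - y) ?_ ?_
  · intro y hy
    rw [Finset.mem_coe, mem_bichromaticPairs] at hy
    simp only [Finset.coe_filter, Set.mem_ofPred_eq, Finset.mem_Icc]
    split_ifs with h
    · exact ⟨hy.1, h⟩
    · refine ⟨by omega, ?_⟩
      rw [hy.2.2]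
      revert h
      cases χ y <;> cases c <;> simp
  · intro y hy z hz h
    rw [Finset.mem_coe, mem_bichromaticPairs] at hy hz
    simp only at h
    split_ifs at h <;> omega

theorem sum_Icc_eq_sum_reflect (m : ℕ) (f : ℕ → ℝ) :
    ∑ y ∈ Finset.Icc 1 m, f (m + 1 - y) = ∑ y ∈ Finset.Icc 1 m, f y := by
  refine Finset.sum_nbij' (fun y => m + 1 - y) (fun y => m + 1 - y) ?_ ?_ ?_ ?_ ?_
  all_goals
    intro y hy
    simp only [Finset.mem_Icc] at hy ⊢
    try omega

/-- The matched inequalities are summed over all `y`, so everything is counted twice. A midpoint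
matched with itself falls under equal colours and has no excess. -/
theorem sum_pairCount_le {a n m : ℕ} (χ : ℕ → Bool) (ham : a * m ≤ n)
    (hn : n ≤ a * (m + 1)) :
    ∑ y ∈ Finset.Icc 1 m, pairCount a n χ y ≤
      ∑ y ∈ Finset.Icc 1 m, (colorCount χ (!χ y) n : ℝ) +
        ∑ y ∈ bichromaticPairs m χ, pairExcess a n χ y := by
  set G : ℕ → ℝ := fun y => if y ∈ bichromaticPairs m χ then pairExcess a n χ y else 0 with hG
  have hE : ∑ y ∈ bichromaticPairs m χ, pairExcess a n χ y = ∑ y ∈ Finset.Icc 1 m, G y := by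
    rw [← Finset.sum_filter]
    refine Finset.sum_congr (Finset.ext fun y => ?_) fun _ _ => rfl
    rw [Finset.mem_filter, mem_bichromaticPairs, Finset.mem_Icc]
    tauto
  have key : ∀ y ∈ Finset.Icc 1 m, pairCount a n χ y + pairCount a n χ (m + 1 - y) ≤
      (colorCount χ (!χ y) n : ℝ) + colorCount χ (!χ (m + 1 - y)) n + (G y + G (m + 1 - y)) := by
    intro y hy
    rw [Finset.mem_Icc] at hy
    obtain ⟨z, hz⟩ : ∃ z, z = m + 1 - y := ⟨_, rfl⟩
    have hzy : y = m + 1 - z := by omega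
    have hsum : n ≤ a * y + a * z := by
      rw [← mul_add, show y + z = m + 1 by omega]
      exact hn
    have hy' : a * y ≤ n := (Nat.mul_le_mul_left a hy.2).trans ham
    have hz' : a * z ≤ n := (Nat.mul_le_mul_left a (by omega)).trans ham
    rw [← hz]
    simp only [hG, mem_bichromaticPairs]
    rw [← hz, ← hzy]
    by_cases hc : χ y = χ z
    · rw [if_neg (by rw [hc]; simp), if_neg (by rw [hc]; simp)]
      linarith [pairCount_add_le_of_eq hsum hz' hc]
    have hc' : χ z = !χ y := by
      revert hc
      cases χ y <;> cases χ z <;> simp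
    have hc'' : χ y = !χ z := by rw [hc', Bool.not_not]
    have hne : y ≠ z := fun h => hc (congrArg χ h)
    rcases hne.lt_or_gt with h | h
    · rw [if_pos ⟨hy, by omega, hc'⟩, if_neg (by omega)]
      linarith [pairCount_add_le_of_ne hsum hy' hc']
    · rw [if_neg (by omega), if_pos ⟨by omega, by omega, hc''⟩]
      linarith [pairCount_add_le_of_ne (by omega) hz' hc'']
  have := Finset.sum_le_sum key
  rw [Finset.sum_add_distrib, Finset.sum_add_distrib, Finset.sum_add_distrib,
    Finset.sum_add_distrib, sum_Icc_eq_sum_reflect m (pairCount a n χ),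
    sum_Icc_eq_sum_reflect m (fun y => (colorCount χ (!χ y) n : ℝ)),
    sum_Icc_eq_sum_reflect m G] at this
  rw [hE]
  linarith

theorem sum_opposite_colorCount (χ : ℕ → Bool) (c : Bool) (m n : ℕ) :
    ∑ y ∈ Finset.Icc 1 m, (colorCount χ (!χ y) n : ℝ) =
      colorCount χ c m * colorCount χ (!c) n + colorCount χ (!c) m * colorCount χ c n := by
  have h1 := sum_ne_eq_colorCount χ (!c) m
  have h2 := sum_ne_eq_colorCount χ c m
  rw [Bool.not_not] at h1
  rw [← h1, ← h2, Finset.sum_mul, Finset.sum_mul, ← Finset.sum_add_distrib]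
  refine Finset.sum_congr rfl fun y _ => ?_
  cases χ y <;> cases c <;> simp

/-- These are the three sides of the trapezoid. They bound from below the number of elements
coloured like `y` in `(a * y, n - a * y]`; the last uses `m ≤ n - a * y`. -/
theorem pairExcess_le {a n m y : ℕ} {χ : ℕ → Bool} (ha : 2 ≤ a) (ham : a * m ≤ n)
    (hy : 2 * y ≤ m) :
    pairExcess a n χ y ≤ n - 2 * (a * y) ∧
    pairExcess a n χ y ≤ n - 2 * colorCount χ (χ y) n + 2 * (a * y) ∧
    pairExcess a n χ y ≤ n - 2 * colorCount χ (χ y) m := by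
  have hay : 2 * (a * y) ≤ n := by
    calc 2 * (a * y) = a * (2 * y) := by ring
      _ ≤ a * m := Nat.mul_le_mul_left a hy
      _ ≤ n := ham
  have hm : 2 * m ≤ n := (Nat.mul_le_mul_right m ha).trans ham
  have h1 : (colorCount χ (χ y) (a * y) : ℝ) ≤ colorCount χ (χ y) (n - a * y) :=
    Nat.cast_le.2 (colorCount_mono _ _ (by omega))
  have h2 : (colorCount χ (χ y) n : ℝ) ≤ colorCount χ (χ y) (n - a * y) + a * y := by
    have := colorCount_le_add χ (χ y) (Nat.sub_le n (a * y))
    have : colorCount χ (χ y) n ≤ colorCount χ (χ y) (n - a * y) + a * y := by omega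
    exact_mod_cast this
  have h3 : (colorCount χ (χ y) m : ℝ) ≤ colorCount χ (χ y) (n - a * y) :=
    Nat.cast_le.2 (colorCount_mono _ _ (by omega))
  have h4 : (colorCount χ (χ y) (a * y) : ℝ) ≤ a * y := by
    have := colorCount_add_not χ (χ y) (a * y)
    have : colorCount χ (χ y) (a * y) ≤ a * y := by omega
    exact_mod_cast this
  rw [pairExcess]
  exact ⟨by linarith, by linarith, by linarith⟩

/-- The upper bound in terms of the colour counts, before optimization. Here `μ` is a
Lagrange multiplier and `β` the height of a plateau. -/
theorem mul_nonMonoQ_le {a n m : ℕ} (ha : 2 ≤ a) (χ : ℕ → Bool) (c d : Bool)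
    (hm : m = (n - 1) / a) (hn : 1 ≤ n)
    (hc : colorCount χ (!c) n ≤ colorCount χ c n)
    {β : ℝ} (hβB : β ≤ colorCount χ (!c) n) (hBβ : colorCount χ (!c) n ≤ 2 * β)
    (hβ1 : 2 * β ≤ colorCount χ c n ∨ β ≤ colorCount χ c m)
    (hβ2 : β ≤ colorCount χ (!c) m ∨ 2 * β ≤ colorCount χ (!c) n)
    {μ : ℝ} (hμB : colorCount χ (!c) n ≤ μ) (hμn : 2 * μ ≤ n) :
    a * (nonMonoQ a n χ : ℝ) ≤
      colorCount χ c n * colorCount χ (!c) n + (a : ℝ) ^ 2 / 16 +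
      a * (colorCount χ c m * colorCount χ (!c) n + colorCount χ (!c) m * colorCount χ c n) +
      (a * ((n - 2 * μ) * colorCount χ d m) +
      (μ ^ 2 - ((colorCount χ (!c) n - β) ^ 2 + β ^ 2) - a * (μ - colorCount χ (!c) n) +
        (a : ℝ) ^ 2 / 4)) := by
  have ha1 : 1 ≤ a := by omega
  have ham : a * m ≤ n := by
    have := Nat.mul_div_le (n - 1) a
    rw [hm]
    omega
  have hn' : n ≤ a * (m + 1) := by
    have := Nat.lt_mul_div_succ (n - 1) (show 0 < a by omega)
    rw [hm]
    omega
  have hB0 : (0 : ℝ) ≤ colorCount χ (!c) n := Nat.cast_nonneg _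
  have hcR : (colorCount χ (!c) n : ℝ) ≤ colorCount χ c n := Nat.cast_le.2 hc
  have hRB : (colorCount χ c n : ℝ) + colorCount χ (!c) n = n :=
    mod_cast colorCount_add_not χ c n
  set E := bichromaticPairs m χ
  have hexc : ∀ y ∈ E, 1 ≤ y ∧ pairExcess a n χ y ≤ n - 2 * (a * y) ∧
      pairExcess a n χ y ≤ n - 2 * colorCount χ (!c) n + 2 * (a * y) ∧
      pairExcess a n χ y ≤ n - 2 * β := fun y hy => by
    obtain ⟨hy1, hy2, _⟩ := mem_bichromaticPairs.1 hy
    obtain ⟨h1, h2, h3⟩ := pairExcess_le (χ := χ) ha ham hy2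
    refine ⟨hy1.1, h1, ?_⟩
    by_cases hyc : χ y = c
    · rw [hyc] at h2 h3
      refine ⟨by linarith, ?_⟩
      -- If `2 * β` is at most the total count, the plateau bound is the average of the two sloping
      -- ones; otherwise it is the bound by the count on `[1, m]`.
      rcases hβ1 with h | h <;> linarith
    · have hyc' : χ y = !c := by
        revert hyc
        cases χ y <;> cases c <;> simp
      rw [hyc'] at h2 h3
      refine ⟨h2, ?_⟩
      rcases hβ2 with h | h <;> linarith
  have htrap := mul_sum_le_of_trapezoid (a := a) (β := β) (μ := μ) (by positivity) (by linarith)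
    hβB hBβ hμB E (fun y hy => (hexc y hy).1) (fun y => pairExcess a n χ y - (n - 2 * μ))
    (fun y hy => by linarith [(hexc y hy).2.1]) (fun y hy => by linarith [(hexc y hy).2.2.2])
    (fun y hy => by linarith [(hexc y hy).2.2.1])
  rw [Finset.sum_sub_distrib, Finset.sum_const, nsmul_eq_mul] at htrap
  have hcard : (E.card : ℝ) * (n - 2 * μ) ≤ (n - 2 * μ) * colorCount χ d m := by
    rw [mul_comm]
    exact mul_le_mul_of_nonneg_left (Nat.cast_le.2 (card_bichromaticPairs_le m χ d))
      (by linarith)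
  have hcard' := mul_le_mul_of_nonneg_left hcard (Nat.cast_nonneg (α := ℝ) a)
  have hpair := sum_pairCount_le χ ham hn'
  rw [sum_opposite_colorCount χ c] at hpair
  have hpair' := mul_le_mul_of_nonneg_left hpair (Nat.cast_nonneg (α := ℝ) a)
  have hres := sum_same_residue_ne_le a n ha1 χ c
  have hQ : (nonMonoQ a n χ : ℝ) = ∑ y ∈ Finset.Icc 1 m, pairCount a n χ y +
      ∑ y ∈ Finset.Icc 1 ((n - 1) / a), ∑ x ∈ Finset.Icc 1 (n - a * y),
        (if χ x ≠ χ (x + a * y) then (1 : ℝ) else 0) := by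
    rw [nonMonoQ_eq_sum a n ha1, hm, ← Finset.sum_add_distrib]
    refine Finset.sum_congr rfl fun y hy => ?_
    rw [Finset.sum_add_distrib, sum_eq_pairCount χ (by have := mul_le_of_mem_Icc_div ha1 hy; omega)]
  rw [hQ]
  linarith

/-! ### Optimization over the colour counts -/

/-- Cauchy–Schwarz for the three squares of the optimization. -/
theorem sq_le_mul_three_squares {a x y z S : ℝ} (hS : 0 ≤ S) (h : S ≤ x + y + (a + 1) * z) :
    S ^ 2 ≤ (a ^ 2 + 2 * a + 3) * (x ^ 2 + (y ^ 2 + z ^ 2)) := by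
  have h1 : S ^ 2 ≤ (x + y + (a + 1) * z) ^ 2 := pow_le_pow_left₀ hS h 2
  nlinarith [sq_nonneg (x - y), sq_nonneg ((a + 1) * x - z), sq_nonneg ((a + 1) * y - z)]

/-- The optimization when the minority colour on `[1, n]` is the majority colour on `[1, m]`. -/
theorem optimize_opposite_minorities {a n m R B r b : ℝ} (ha : 2 ≤ a)
    (hn : a * (a ^ 2 + 2 * a + 3) ≤ n) (hRB : R + B = n) (hrb : r + b = m) (hBR : B ≤ R)
    (hr : r ≤ b) (hbB : b ≤ B) (hr0 : 0 ≤ r) (hmn : a * m + 1 ≤ n) :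
    ∃ β μ : ℝ, β ≤ B ∧ B ≤ 2 * β ∧ (2 * β ≤ R ∨ β ≤ r) ∧ (β ≤ b ∨ 2 * β ≤ B) ∧
      B ≤ μ ∧ 2 * μ ≤ n ∧
      R * B + a ^ 2 / 16 + a * (r * B + b * R) + (a * ((n - 2 * μ) * r) +
        (μ ^ 2 - ((B - β) ^ 2 + β ^ 2) - a * (μ - B) + a ^ 2 / 4)) ≤
      n ^ 2 - n ^ 2 / (a ^ 2 + 2 * a + 3) := by
  obtain ⟨N, hN⟩ : ∃ N, N = a ^ 2 + 2 * a + 3 := ⟨_, rfl⟩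
  obtain ⟨s, hs⟩ : ∃ s, s = n - a * m := ⟨_, rfl⟩
  have hs1 : 1 ≤ s := by linarith
  have hN11 : 11 ≤ N := by nlinarith
  have han : 10 * a ^ 2 ≤ 3 * n := by nlinarith [mul_nonneg (by linarith : 0 ≤ a) (sq_nonneg (a - 1))]
  have hn0 : 0 < n := by nlinarith
  have har0 : 0 ≤ a * r := by positivity
  have harb : a * r + a * b = n - s := by rw [hs, ← hrb]; ring
  have harle : a * r ≤ a * b := mul_le_mul_of_nonneg_left hr (by linarith)
  have hab : 2 * b ≤ a * b := mul_le_mul_of_nonneg_right ha (hr0.trans hr)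
  rw [← hN]
  have hqN : n ^ 2 / N * N = n ^ 2 := div_mul_cancel₀ _ (by linarith)
  have hq11 : n ^ 2 / N ≤ n ^ 2 / 11 := div_le_div_of_nonneg_left (by positivity) (by norm_num) hN11
  have hsR : s * n / 2 ≤ s * R := by nlinarith
  have hsn : n ≤ s * n := by nlinarith
  -- After completing squares, the term `s * R`, due to `a * m` falling short of `n`, pays for the
  -- lower-order errors.
  have hbase : ∀ β μ : ℝ, R * B + a ^ 2 / 16 + a * (r * B + b * R) + (a * ((n - 2 * μ) * r) +
        (μ ^ 2 - ((B - β) ^ 2 + β ^ 2) - a * (μ - B) + a ^ 2 / 4)) =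
      n ^ 2 - (B - a * r) ^ 2 + (μ - a * r) ^ 2 - ((B - β) ^ 2 + β ^ 2) - s * R - a * (μ - B) +
        5 * a ^ 2 / 16 := fun β μ => by
    have h1 : a * b = n - s - a * r := by linarith
    have h2 : R = n - B := by linarith
    have h3 : a * (r * B + b * R) = a * r * B + a * b * R := by ring
    rw [h3, h1, h2]
    ring
  have hμ : ∀ μ, μ = max B (a * r) → B ≤ μ ∧ 2 * μ ≤ n ∧ a * r ≤ μ ∧
      (B - a * r) ^ 2 - (μ - a * r) ^ 2 = (μ - B) ^ 2 := fun μ h => by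
    rcases max_cases B (a * r) with ⟨h1, h2⟩ | ⟨h1, h2⟩ <;> rw [h, h1]
    · exact ⟨le_rfl, by linarith, h2, by ring⟩
    · exact ⟨h2.le, by linarith, le_rfl, by ring⟩
  -- The linear constraint is `n - s = a * r + a * b ≤ μ + a * β = (μ - B) + (B - β) + (a + 1) * β`.
  have main : ∀ β, b ≤ β → ∀ μ, μ = max B (a * r) →
      n ^ 2 - (B - a * r) ^ 2 + (μ - a * r) ^ 2 - ((B - β) ^ 2 + β ^ 2) - s * R - a * (μ - B) +
        5 * a ^ 2 / 16 ≤ n ^ 2 - n ^ 2 / N := fun β hβ μ h => by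
    obtain ⟨h1, _, h3, h4⟩ := hμ μ h
    have hcs := sq_le_mul_three_squares (a := a) (x := μ - B) (y := B - β) (z := β) (S := n - s)
      (by linarith) (by nlinarith)
    rw [← hN] at hcs
    have h5 : n ^ 2 / N - 2 * (n * s) / 11 ≤ (μ - B) ^ 2 + ((B - β) ^ 2 + β ^ 2) := by
      have hns : 0 ≤ n * s := by positivity
      have : n ^ 2 / N - 2 * (n * s) / N ≤ (μ - B) ^ 2 + ((B - β) ^ 2 + β ^ 2) := by
        rw [← sub_div, div_le_iff₀ (by linarith)]
        nlinarith [sq_nonneg s]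
      have h6 : 2 * (n * s) / N ≤ 2 * (n * s) / 11 :=
        div_le_div_of_nonneg_left (by positivity) (by norm_num) hN11
      linarith
    have h7 : 0 ≤ a * (μ - B) := mul_nonneg (by linarith) (by linarith)
    linarith
  -- The plateau `β` is `b` clamped to `[B / 2, R / 2]`; clamping at `R / 2` already leaves a
  -- deficit of `n ^ 2 / 10`.
  rcases lt_or_ge R (2 * b) with hRb | hRb
  · refine ⟨R / 2, max B (a * r), by linarith, by linarith, Or.inl (by linarith),
      Or.inl (by linarith), (hμ _ rfl).1, (hμ _ rfl).2.1, ?_⟩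
    rw [hbase]
    have h1 := (hμ _ rfl).2.2.2
    have h7 : 0 ≤ a * (max B (a * r) - B) := mul_nonneg (by linarith) (by linarith [(hμ _ rfl).1])
    have hG : n ^ 2 / 10 ≤ (B - R / 2) ^ 2 + (R / 2) ^ 2 := by
      rw [show B = n - R by linarith]
      nlinarith [sq_nonneg (5 * R - 3 * n)]
    have := sq_nonneg (max B (a * r) - B)
    nlinarith
  · rcases le_total (2 * b) B with hbB2 | hbB2
    · refine ⟨B / 2, max B (a * r), by linarith, by linarith, Or.inl (by linarith),
        Or.inr (by linarith), (hμ _ rfl).1, (hμ _ rfl).2.1, ?_⟩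
      rw [hbase]
      exact main _ (by linarith) _ rfl
    · refine ⟨b, max B (a * r), hbB, hbB2, Or.inl hRb, Or.inl le_rfl, (hμ _ rfl).1,
        (hμ _ rfl).2.1, ?_⟩
      rw [hbase]
      exact main _ le_rfl _ rfl

/-- The optimization when one colour is the minority on both `[1, n]` and `[1, m]`. -/
theorem optimize_same_minority {a n m R B r b : ℝ} (ha : a = 2 ∨ 3 ≤ a)
    (hn : a * (a ^ 2 + 2 * a + 3) ≤ n) (hRB : R + B = n) (hrb : r + b = m) (hBR : B ≤ R)
    (hr : b ≤ r) (hbB : b ≤ B) (hb0 : 0 ≤ b) (hmn : a * m + 1 ≤ n) :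
    ∃ β μ : ℝ, β ≤ B ∧ B ≤ 2 * β ∧ (2 * β ≤ R ∨ β ≤ r) ∧ (β ≤ b ∨ 2 * β ≤ B) ∧
      B ≤ μ ∧ 2 * μ ≤ n ∧
      R * B + a ^ 2 / 16 + a * (r * B + b * R) + (a * ((n - 2 * μ) * b) +
        (μ ^ 2 - ((B - β) ^ 2 + β ^ 2) - a * (μ - B) + a ^ 2 / 4)) ≤
      n ^ 2 - n ^ 2 / (a ^ 2 + 2 * a + 3) := by
  have ha2 : 2 ≤ a := by rcases ha with h | h <;> linarith
  obtain ⟨s, hs⟩ : ∃ s, s = n - a * m := ⟨_, rfl⟩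
  have hs1 : 1 ≤ s := by linarith
  have hN11 : 11 ≤ a ^ 2 + 2 * a + 3 := by nlinarith
  have hna : 11 * a ≤ n := by nlinarith
  have hna2 : 121 * a ^ 2 ≤ n ^ 2 := by nlinarith
  have hq11 : n ^ 2 / (a ^ 2 + 2 * a + 3) ≤ n ^ 2 / 11 :=
    div_le_div_of_nonneg_left (by positivity) (by norm_num) hN11
  have harb : a * r + a * b = n - s := by rw [hs, ← hrb]; ring
  have harle : a * b ≤ a * r := mul_le_mul_of_nonneg_left hr (by linarith)
  have hab : 2 * b ≤ a * b := mul_le_mul_of_nonneg_right ha2 hb0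
  have hsB : B ≤ s * B := by nlinarith
  have hbase : ∀ β μ : ℝ, R * B + a ^ 2 / 16 + a * (r * B + b * R) + (a * ((n - 2 * μ) * b) +
        (μ ^ 2 - ((B - β) ^ 2 + β ^ 2) - a * (μ - B) + a ^ 2 / 4)) =
      n ^ 2 - (R - a * b) ^ 2 + (μ - a * b) ^ 2 - ((B - β) ^ 2 + β ^ 2) - s * B - a * (μ - B) +
        5 * a ^ 2 / 16 := fun β μ => by
    have h1 : a * r = n - s - a * b := by linarith
    have h2 : R = n - B := by linarith
    have h3 : a * (r * B + b * R) = a * r * B + a * b * R := by ring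
    rw [h3, h1, h2]
    ring
  rcases lt_or_ge (a * b) B with hwB | hwB
  · refine ⟨B / 2, B, by linarith, by linarith, Or.inl (by linarith), Or.inr (by linarith),
      le_rfl, by linarith, ?_⟩
    rw [hbase]
    have h1 : (n - 2 * B) ^ 2 ≤ (R - a * b) ^ 2 - (B - a * b) ^ 2 := by
      rw [show R = n - B by linarith]
      nlinarith [mul_nonneg (by linarith : 0 ≤ n - 2 * B) (by linarith : 0 ≤ B - a * b)]
    have h2 : n ^ 2 / 9 ≤ (n - 2 * B) ^ 2 + B ^ 2 / 2 := by
      nlinarith [sq_nonneg (9 * B - 4 * n)]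
    nlinarith
  · have haμ : 0 ≤ a * (a * b - B) := mul_nonneg (by linarith) (by linarith)
    rcases ha with rfl | ha3
    · refine ⟨b, 2 * b, hbB, hwB, Or.inr hr, Or.inl le_rfl, hwB, by linarith, ?_⟩
      rw [hbase]
      -- Without `4 * b ≤ n` the minimum would be `n ^ 2 / 11`, with no room for errors. With it,
      -- the minimum `3 / 32 * n ^ 2` is at `b = n / 4`, `B = 3 * n / 8`.
      have h1 : 3 / 32 * n ^ 2 ≤ (R - 2 * b) ^ 2 + ((B - b) ^ 2 + b ^ 2) := by
        rw [show R = n - B by linarith]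
        linarith [sq_nonneg (B + 2 * b - 7 * n / 8), sq_nonneg (B - b - n / 8),
          sq_nonneg (b - n / 4), mul_nonneg (by linarith : 0 ≤ n) (by linarith : 0 ≤ n - 4 * b)]
      have h2 : (2 * b - 2 * b) ^ 2 = 0 := by ring
      linarith
    · refine ⟨max b (B / 2), a * b, max_le hbB (by linarith),
        by linarith [le_max_right b (B / 2)], ?_, ?_, hwB, by linarith, ?_⟩
      · rcases max_choice b (B / 2) with h | h <;> rw [h]
        · exact Or.inr hr
        · exact Or.inl (by linarith)
      · rcases max_choice b (B / 2) with h | h <;> rw [h]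
        · exact Or.inl le_rfl
        · exact Or.inr (by linarith)
      · rw [hbase]
        generalize max b (B / 2) = β
        have h1 : (n / 2 - B) ^ 2 ≤ (R - a * b) ^ 2 :=
          pow_le_pow_left₀ (by linarith) (by linarith) 2
        have h2 : B ^ 2 / 2 ≤ (B - β) ^ 2 + β ^ 2 := by nlinarith [sq_nonneg (B - 2 * β)]
        -- The minimum is at `B = n / 3`. The value `n ^ 2 / 12` beats `n ^ 2 / 18` but not the `n ^
        -- 2 / 11` needed for `a = 2`, hence the separate case.
        have h3 : n ^ 2 / 12 ≤ (n / 2 - B) ^ 2 + B ^ 2 / 2 := by nlinarith [sq_nonneg (3 * B - n)]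
        have h4 : n ^ 2 / (a ^ 2 + 2 * a + 3) ≤ n ^ 2 / 18 :=
          div_le_div_of_nonneg_left (by positivity) (by norm_num)
            (by linarith [pow_le_pow_left₀ (by norm_num) ha3 2])
        have h5 : (a * b - a * b) ^ 2 = 0 := by ring
        linarith

/-! ### Conclusion -/

theorem theorem3 (a n : ℕ) (ha : 2 ≤ a) (χ : ℕ → Bool) :
    (nonMonoQ a n χ : ℝ) ≤
      (n : ℝ) ^ 2 / (a : ℝ) * (1 - 1 / ((a : ℝ) ^ 2 + 2 * (a : ℝ) + 3)) := by
  have haR : (2 : ℝ) ≤ a := mod_cast ha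
  have ha0 : (0 : ℝ) < a := by linarith
  have hN : (0 : ℝ) < (a : ℝ) ^ 2 + 2 * a + 3 := by positivity
  suffices h : a * (nonMonoQ a n χ : ℝ) ≤ (n : ℝ) ^ 2 - (n : ℝ) ^ 2 / ((a : ℝ) ^ 2 + 2 * a + 3) by
    rw [show (n : ℝ) ^ 2 / a * (1 - 1 / ((a : ℝ) ^ 2 + 2 * a + 3)) =
      ((n : ℝ) ^ 2 - (n : ℝ) ^ 2 / ((a : ℝ) ^ 2 + 2 * a + 3)) / a by field_simp,
      le_div_iff₀ ha0, mul_comm]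
    exact h
  obtain ⟨m, hm⟩ : ∃ m, m = (n - 1) / a := ⟨_, rfl⟩
  have hamn : a * m ≤ n - 1 := by rw [hm]; exact Nat.mul_div_le _ _
  rcases le_or_gt (m + 1) (a ^ 2 + 2 * a + 3) with hsmall | hlarge
  · have h1 := mul_le_mul_of_nonneg_left (nonMonoQ_le_two_mul_card a n (by omega) χ) ha0.le
    refine h1.trans ?_
    rw [← hm, le_sub_iff_add_le, ← le_sub_iff_add_le', div_le_iff₀ hN]
    have hsm : (m : ℝ) + 1 ≤ (a : ℝ) ^ 2 + 2 * a + 3 := mod_cast hsmall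
    have hm0 : (0 : ℝ) ≤ m := Nat.cast_nonneg _
    obtain ⟨σ, hσ⟩ : ∃ σ : ℝ, σ = n - a * m := ⟨_, rfl⟩
    have hcs : (n : ℝ) ^ 2 ≤ (m + 1) * (a ^ 2 * m + σ ^ 2) := by
      rw [show (n : ℝ) = a * m + σ by rw [hσ]; ring]
      -- This is Cauchy–Schwarz for `n` written as `m` copies of `a` plus `σ`; the trivial bound on
      -- `a * Q` equals `n ^ 2 - (a ^ 2 * m + σ ^ 2)`.
      nlinarith [mul_nonneg hm0 (sq_nonneg (a - σ))]
    calc (n : ℝ) ^ 2 ≤ (m + 1) * (a ^ 2 * m + σ ^ 2) := hcs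
      _ ≤ ((a : ℝ) ^ 2 + 2 * a + 3) * (a ^ 2 * m + σ ^ 2) := by gcongr
      _ = _ := by rw [hσ]; ring
  · have hn1 : 1 ≤ n := by
      rcases Nat.eq_zero_or_pos n with h | h
      · subst h
        have : m = 0 := by rw [hm]; simp
        nlinarith
      · exact h
    have hmnR : (a : ℝ) * m + 1 ≤ n := by
      have : a * m + 1 ≤ n := by omega
      exact_mod_cast this
    have hlR : ((a : ℝ) ^ 2 + 2 * a + 3) ≤ m := by
      have : a ^ 2 + 2 * a + 3 ≤ m := by omega
      exact_mod_cast this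
    have hnN : (a : ℝ) * ((a : ℝ) ^ 2 + 2 * a + 3) ≤ n := by nlinarith
    have hmn : m ≤ n := by nlinarith [Nat.sub_le n 1]
    obtain ⟨c, hc⟩ : ∃ c, colorCount χ (!c) n ≤ colorCount χ c n := by
      rcases le_total (colorCount χ true n) (colorCount χ false n) with h | h
      · exact ⟨false, h⟩
      · exact ⟨true, h⟩
    have hcR : (colorCount χ (!c) n : ℝ) ≤ colorCount χ c n := Nat.cast_le.2 hc
    have hRB : (colorCount χ c n : ℝ) + colorCount χ (!c) n = n :=
      mod_cast colorCount_add_not χ c n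
    have hrb : (colorCount χ c m : ℝ) + colorCount χ (!c) m = m :=
      mod_cast colorCount_add_not χ c m
    have hbB : (colorCount χ (!c) m : ℝ) ≤ colorCount χ (!c) n :=
      Nat.cast_le.2 (colorCount_mono _ _ hmn)
    rcases le_total (colorCount χ c m) (colorCount χ (!c) m) with h | h
    · obtain ⟨β, μ, h1, h2, h3, h4, h5, h6, h7⟩ := optimize_opposite_minorities haR hnN hRB hrb hcR
        (Nat.cast_le.2 h) hbB (Nat.cast_nonneg _) hmnR
      exact (mul_nonMonoQ_le ha χ c c hm hn1 hc h1 h2 h3 h4 h5 h6).trans h7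
    · have ha' : (a : ℝ) = 2 ∨ (3 : ℝ) ≤ a := by
        rcases ha.eq_or_lt with h | h
        · left; exact_mod_cast h.symm
        · right; exact_mod_cast h
      obtain ⟨β, μ, h1, h2, h3, h4, h5, h6, h7⟩ := optimize_same_minority ha' hnN hRB hrb hcR
        (Nat.cast_le.2 h) hbB (Nat.cast_nonneg _) hmnR
      exact (mul_nonMonoQ_le ha χ c (!c) hm hn1 hc h1 h2 h3 h4 h5 h6).trans h7
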